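/- **Definitions.** All graphs are finite, undirected and simple. *Paley graph.* For a prime power $q\equiv 1 \pmod 4$, $P(q)$ is the graph with vertex set $\mathbb F_q$ in which distinct $x,y$ are adjacent if and only if $x-y$ is a square in $\mathbb F_q$. *Peisert graph.* For $q=p^r\ge 5$ with $p$ prime, $p\equiv 3\pmod 4$ and $r$ even, $P^*(q)$ is the graph with vertex set $\mathbb F_q$ in which distinct $x,y$ are adjacent if and only if $x-y\in\{w^j : j\equiv 0,1 \pmod 4\}$, where $w$ is a (fixed, arbitrary) primitive root of $\mathbb F_q$. *Taylor extension.* The Taylor double of a graph $G$ has vertex set $\{x^{\varepsilon} : x\in V(G),\ \varepsilon=\pm1\}$; vertices $x^\delta,y^\varepsilon$ are adjacent if and only if $x\ne y$ and $\delta\varepsilon=1$ when $x\sim y$, $\delta\varepsilon=-1$ when $x\not\sim y$. The Taylor extension of $\Delta$ is the Taylor double of $\{\infty\}+\Delta$, the graph obtained from $\Delta$ by adding a new vertex $\infty$ adjacent to every vertex of $\Delta$. *Bipartite double.* The bipartite double of $\Sigma$ has vertex set $V(\Sigma)\times\{0,1\}$, with $(x,i)\sim(y,j)$ if and only if $x\sim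 y$ in $\Sigma$ and $i\ne j$. *Amply regular.* A graph is amply regular with parameters $(v,k,\lambda,\mu)$ if it has $v$ vertices, is $k$-regular, any two adjacent vertices have exactly $\lambda$ common neighbours, and any two vertices at distance $2$ have exactly $\mu$ common neighbours. *$Q$-regular.* A partition $\{B_i\}$ of the vertex set of a graph into non-empty cells is equitable with quotient matrix $Q=(q_{ij})$ if every vertex in $B_i$ has exactly $q_{ij}$ neighbours in $B_j$, for all $i,j$. Its distribution diagram records $Q$ and the cell sizes $|B_i|$. A graph $\Gamma$ is $Q$-regular with a given distribution diagram if for each vertex $x$ there is an equitable partition of $V(\Gamma)$ with this distribution diagram such that $\{x\}$ is one of its cells. **Proposition.** Let $\Delta$ be either the Paley graph $P(q)$, where $q$ is a prime power with $q\equiv1\pmod 4$, or the Peisert graph $P^*(q)$, where $q=p^r\ge5$ with $p$ prime, $p\equiv3\pmod4$ and $r$ even. Let $\Sigma$ be the Taylor extension of $\Delta$ and let $\Gamma$ be the bipartite double of $\Sigma$. Then $\Gamma$ is a connected bipartite amply regular graph with diameter $4$ and parameters $(v,k,\lambda,\mu)=\left(4(q+1),\,q,\,0,\,\frac{q-1}{2}\right)$,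 and $\Gamma$ is $Q$-regular with the distribution diagram that has six cells $B_0,\dots,B_5$ of sizes $1,\,q,\,2q,\,q,\,1,\,2$ and quotient matrix $$Q=\begin{pmatrix}0&q&0&0&0&0\\1&0&q-1&0&0&0\\0&\frac{q-1}2&0&\frac{q-1}2&0&1\\0&0&q-1&0&1&0\\0&0&0&q&0&0\\0&0&q&0&0&0\end{pmatrix}.$$ -/

import Mathlib

/-! ### Paley and Peisert graphs -/

/-- The Paley graph on a finite field `F` with `|F| ≡ 1 (mod 4)`: two distinct elements are
adjacent iff their difference is a square. -/
def paleyGraph (F : Type*) [Field F] [Fintype F] (hF : Fintype.card F % 4 = 1) :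
    SimpleGraph F where
  Adj x y := x ≠ y ∧ IsSquare (x - y)
  symm := ⟨by
    rintro x y ⟨hxy, hs⟩
    have h1 : IsSquare (-1 : F) := FiniteField.isSquare_neg_one_iff.2 (by omega)
    refine ⟨hxy.symm, ?_⟩
    have h2 := h1.mul hs
    rwa [neg_one_mul, neg_sub] at h2⟩
  loopless := ⟨fun _ h => h.1 rfl⟩

/-- The connection set `M = {w ^ j : j ≡ 0, 1 (mod 4)}` of the Peisert graph. -/
def peisertSet {F : Type*} [Field F] (w : F) : Set F :=
  {a | ∃ j : ℕ, (j % 4 = 0 ∨ j % 4 = 1) ∧ a = w ^ j}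

theorem neg_mem_peisertSet {F : Type*} [Field F] [Fintype F] {p r : ℕ}
    (hp4 : p % 4 = 3) (hr : Even r) (hq : 5 ≤ p ^ r) (hF : Fintype.card F = p ^ r)
    {w : F} (hw : IsPrimitiveRoot w (Fintype.card F - 1)) {a : F} (ha : a ∈ peisertSet w) :
    -a ∈ peisertSet w := by
  obtain ⟨j, hj, rfl⟩ := ha
  have h8 : p ^ r % 8 = 1 := by
    obtain ⟨s, rfl⟩ := hr
    have hp2 : p * p % 8 = 1 := by
      have : p % 8 = 3 ∨ p % 8 = 7 := by omega
      rcases this with h | h <;> simp [Nat.mul_mod, h]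
    rw [← two_mul, pow_mul, sq, Nat.pow_mod, hp2]
    simp
  have hneg : w ^ ((p ^ r - 1) / 2) = -1 := by
    rw [hF] at hw
    have h2 := hw.pow (a := (p ^ r - 1) / 2) (b := 2) (by omega) (by omega)
    exact h2.eq_neg_one_of_two_right
  refine ⟨j + (p ^ r - 1) / 2, by omega, ?_⟩
  rw [pow_add, hneg, mul_neg_one]

/-- The Peisert graph on a finite field `F` with `|F| = p ^ r ≥ 5`, where `p` is a prime with
`p ≡ 3 (mod 4)` and `r` is even, and with respect to the primitive root `w` of `F`: two distinct
elements are adjacent iff their difference lies in `{w ^ j : j ≡ 0, 1 (mod 4)}`. -/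
def peisertGraph (F : Type*) [Field F] [Fintype F] (p r : ℕ)
    (hp4 : p % 4 = 3) (hr : Even r) (hq : 5 ≤ p ^ r) (hF : Fintype.card F = p ^ r)
    (w : F) (hw : IsPrimitiveRoot w (Fintype.card F - 1)) : SimpleGraph F where
  Adj x y := x ≠ y ∧ x - y ∈ peisertSet w
  symm := ⟨by
    rintro x y ⟨hxy, h⟩
    refine ⟨hxy.symm, ?_⟩
    have h2 := neg_mem_peisertSet hp4 hr hq hF hw h
    rwa [neg_sub] at h2⟩
  loopless := ⟨fun _ h => h.1 rfl⟩

/-! ### The Taylor extension -/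

/-- The graph `{∞} + Δ`: a new vertex `∞ = none` is joined to every vertex of `Δ`. -/
def coneGraph {V : Type*} (Δ : SimpleGraph V) : SimpleGraph (Option V) where
  Adj
    | none, none => False
    | none, some _ => True
    | some _, none => True
    | some x, some y => Δ.Adj x y
  symm := ⟨by
    rintro (_ | x) (_ | y) h
    · exact h
    · trivial
    · trivial
    · exact Δ.adj_symm h⟩
  loopless := ⟨by
    rintro (_ | x) h
    · exact h
    · exact Δ.irrefl h⟩

/-- The Taylor double of `G`: its vertices are the signed vertices `x ^ ε`, `ε = ± 1`, of `G`, and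
`x ^ δ`, `y ^ ε` with `x ≠ y` are adjacent iff `δ ε = 1` in case `x ∼ y`, and `δ ε = -1` in case
`x ≁ y`. (The vertices `x ^ 1` and `x ^ (-1)` are not adjacent.) -/
def taylorDouble {V : Type*} (G : SimpleGraph V) : SimpleGraph (V × ℤˣ) where
  Adj a b := a.1 ≠ b.1 ∧
    ((G.Adj a.1 b.1 ∧ a.2 * b.2 = 1) ∨ (¬ G.Adj a.1 b.1 ∧ a.2 * b.2 = -1))
  symm := ⟨by
    rintro a b ⟨hne, h⟩
    refine ⟨hne.symm, ?_⟩
    rwa [G.adj_comm, mul_comm]⟩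
  loopless := ⟨fun _ h => h.1 rfl⟩

/-- The Taylor extension of `Δ`: the Taylor double of `{∞} + Δ`. -/
def taylorExtension {V : Type*} (Δ : SimpleGraph V) : SimpleGraph (Option V × ℤˣ) :=
  taylorDouble (coneGraph Δ)

/-! ### Amply regular graphs, equitable partitions, `Q`-regular graphs -/

/-- Amply regular graphs with parameters `(v, k, l, m)`. -/
structure IsAmplyRegular {V : Type*} [Finite V] (G : SimpleGraph V) (v k l m : ℕ) : Prop where
  card : Nat.card V = v
  regular : ∀ x, (G.neighborSet x).ncard = k
  of_adj : ∀ x y, G.Adj x y → (G.commonNeighbors x y).ncard = l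
  of_dist_two : ∀ x y, G.dist x y = 2 → (G.commonNeighbors x y).ncard = m

/-- A distribution diagram: balloons indexed by `ι`, with the cardinality of the cell written in
each balloon and the entries of the quotient matrix written at the lines. -/
structure DistributionDiagram (ι : Type*) where
  /-- the number in the balloon `i`, i.e. the cardinality of the cell `i` -/
  size : ι → ℕ
  /-- `quot i j` is the number of neighbours in cell `j` of each vertex in cell `i` -/
  quot : Matrix ι ι ℕ

/-- `B` is an equitable partition of the vertex set of `G` whose distribution diagram (quotient
matrix together with the cell sizes) is `D`. -/
structure IsEquitablePartition {V ι : Type*} [Finite V] (G : SimpleGraph V) (B : ι → Set V)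
    (D : DistributionDiagram ι) : Prop where
  nonempty : ∀ i, (B i).Nonempty
  disjoint : Pairwise fun i j => Disjoint (B i) (B j)
  cover : ⋃ i, B i = Set.univ
  card : ∀ i, (B i).ncard = D.size i
  quot : ∀ i j, ∀ x ∈ B i, (G.neighborSet x ∩ B j).ncard = D.quot i j

/-- `G` is `Q`-regular with distribution diagram `D`: each vertex `x` is a one-element cell of some
equitable partition with distribution diagram `D`. -/
def IsQRegular {V ι : Type*} [Finite V] (G : SimpleGraph V) (D : DistributionDiagram ι) : Prop :=
  ∀ x : V, ∃ B : ι → Set V, IsEquitablePartition G B D ∧ ∃ i, B i = {x}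

/-- The distribution diagram with six cells, of sizes `1, k, 2k, k, 1` (cells `0` to `4`, in a row)
and `2` (cell `5`, joined only to cell `2`); the row `i` of the matrix lists the number of neighbours
in the cells `0, ..., 5` of a vertex in cell `i`. Used for odd `k`, so `(k - 1) / 2` is exact. -/
def diagramSix (k : ℕ) : DistributionDiagram (Fin 6) where
  size := ![1, k, 2 * k, k, 1, 2]
  quot := !![0, k, 0, 0, 0, 0;
             1, 0, k - 1, 0, 0, 0;
             0, (k - 1) / 2, 0, (k - 1) / 2, 0, 1;
             0, 0, k - 1, 0, 1, 0;
             0, 0, 0, k, 0, 0;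
             0, 0, k, 0, 0, 0]

/-! Everything reduces to one orthogonality property. Encode `Δ` by its sign function `ψ` (the
quadratic character, or `peisertSign`). Its autocorrelations over all shifts add up to `(∑ ψ)² = 0`,
and the shift 0 gives `|F| - 1`; so if the autocorrelation is constant off 0, the constant is `-1`
(`eq_neg_one_of_autocorrelation_eq`). Constancy comes from symmetries: multiplicativity for Paley,
and for Peisert multiplication by `w ^ 2` (which negates `ψ`) together with Frobenius (which acts on
signs like multiplication by `w`).

Hence the Seidel matrix of `{∞} + Δ` is a conference matrix (`IsPaleyType.isConference_coneGraph`).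
In the Taylor double this means that any two vertices in different fibres, adjacent or not, have
exactly `(q - 1) / 2` common neighbours, while the two vertices of a fibre have none. The bipartite
double inherits these counts, which give connectedness, the diameter, ample regularity and the
quotient matrix. -/

open Finset

/-! ### Autocorrelation of integer-valued functions -/

/-- The autocorrelation `a ↦ ∑ z, ψ z * ψ (z - a)` of an integer-valued function. -/
def autocorrelation {F : Type*} [AddGroup F] [Fintype F] (ψ : F → ℤ) (a : F) : ℤ :=
  ∑ z, ψ z * ψ (z - a)

theorem sum_autocorrelation {F : Type*} [AddGroup F] [Fintype F] (ψ : F → ℤ) :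
    ∑ a, autocorrelation ψ a = (∑ z, ψ z) ^ 2 := by
  unfold autocorrelation
  rw [Finset.sum_comm, sq, Finset.sum_mul]
  refine Finset.sum_congr rfl fun z _ => ?_
  rw [← Finset.mul_sum]
  congr 1
  exact (Equiv.subLeft z).sum_comp ψ

theorem eq_neg_one_of_autocorrelation_eq {F : Type*} [AddGroup F] [Fintype F] [Nontrivial F]
    {ψ : F → ℤ} (h0 : ψ 0 = 0) (h1 : ∀ a, a ≠ 0 → ψ a * ψ a = 1) (hsum : ∑ z, ψ z = 0) {c : ℤ}
    (hc : ∀ a, a ≠ 0 → autocorrelation ψ a = c) : c = -1 := by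
  classical
  have hz : autocorrelation ψ 0 = ∑ z ∈ univ.erase (0 : F), (1 : ℤ) := by
    unfold autocorrelation
    rw [← Finset.add_sum_erase _ _ (mem_univ (0 : F))]
    simp only [sub_zero, h0, mul_zero, zero_add]
    exact Finset.sum_congr rfl fun z hz => h1 z (Finset.ne_of_mem_erase hz)
  have h := sum_autocorrelation ψ
  rw [hsum, ← Finset.add_sum_erase _ _ (mem_univ (0 : F)), hz,
    Finset.sum_congr rfl fun z hz => hc z (Finset.ne_of_mem_erase hz), ← Finset.sum_add_distrib,
    Finset.sum_const, nsmul_eq_mul] at h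
  -- At this point `h` says that `(|F| - 1)(1 + c) = 0`.
  have hne : ((#(univ.erase (0 : F)) : ℕ) : ℤ) ≠ 0 := by
    have := Fintype.one_lt_card (α := F)
    rw [Finset.card_erase_of_mem (mem_univ _), Finset.card_univ]
    omega
  have := (mul_eq_zero.1 (by simpa using h)).resolve_left hne
  omega

/-- Reindexing along an additive automorphism of `F` moves it from the shift into the function;
Frobenius is treated in the same way below. -/
theorem autocorrelation_mul {F : Type*} [Field F] [Fintype F] (ψ : F → ℤ) {c : F} (hc : c ≠ 0)
    (a : F) : autocorrelation ψ (c * a) = autocorrelation (fun z => ψ (c * z)) a := by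
  unfold autocorrelation
  rw [← Equiv.sum_comp (Equiv.mulLeft₀ c hc)]
  simp [mul_sub]

theorem autocorrelation_frobenius {F : Type*} [Field F] [Fintype F] (p : ℕ) [Fact p.Prime]
    [CharP F p] (ψ : F → ℤ) (a : F) :
    autocorrelation ψ (a ^ p) = autocorrelation (fun z => ψ (z ^ p)) a := by
  unfold autocorrelation
  rw [← (Equiv.ofBijective (frobenius F p)
    (Finite.injective_iff_bijective.1 (frobenius F p).injective)).sum_comp]
  simp only [Equiv.ofBijective_apply, frobenius_def, sub_pow_char]

/-! ### Graphs of Paley type; Paley graphs -/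

/-- A graph on a finite field is of Paley type if it is the Cayley graph of the set where a
`±1`-valued function `ψ` of sum zero and autocorrelation `-1` takes the value `1`. -/
structure IsPaleyType {F : Type*} [Field F] [Fintype F] (Δ : SimpleGraph F) (ψ : F → ℤ) :
    Prop where
  adj_of_ne : ∀ x y, x ≠ y → (Δ.Adj x y ↔ ψ (x - y) = 1)
  dichotomy : ∀ a, a ≠ 0 → ψ a = 1 ∨ ψ a = -1
  zero : ψ 0 = 0
  sum_eq_zero : ∑ z, ψ z = 0
  autocorrelation_eq : ∀ a, a ≠ 0 → autocorrelation ψ a = -1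

theorem paleyGraph_isPaleyType {F : Type*} [Field F] [Fintype F] [DecidableEq F]
    (hF : Fintype.card F % 4 = 1) : IsPaleyType (paleyGraph F hF) (quadraticChar F) := by
  have h2 : ringChar F ≠ 2 := fun h => by
    have := FiniteField.even_card_of_char_two h
    omega
  have hconst : ∀ a : F, a ≠ 0 → autocorrelation (quadraticChar F) a =
      autocorrelation (quadraticChar F) 1 := fun a ha => by
    conv_lhs => rw [← mul_one a]
    rw [autocorrelation_mul _ ha]
    unfold autocorrelation
    refine Finset.sum_congr rfl fun z _ => ?_
    simp only [map_mul]
    linear_combination (quadraticChar F z * quadraticChar F (z - 1)) * quadraticChar_sq_one ha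
  refine ⟨fun x y hxy => ?_, fun a ha => quadraticChar_dichotomy ha, quadraticChar_zero,
    quadraticChar_sum_zero h2, fun a ha => ?_⟩
  · rw [quadraticChar_one_iff_isSquare (sub_ne_zero.2 hxy)]
    exact and_iff_right hxy
  · rw [hconst a ha]
    exact eq_neg_one_of_autocorrelation_eq quadraticChar_zero
      (fun a ha => by rw [← sq, quadraticChar_sq_one ha]) (quadraticChar_sum_zero h2) hconst

/-! ### Peisert graphs -/

section Peisert

variable {F : Type*} [Field F] [Fintype F] {w : F}

open Classical in
/-- The `±1`-valued function of the Peisert set. -/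
noncomputable def peisertSign (w a : F) : ℤ :=
  if a = 0 then 0 else if a ∈ peisertSet w then 1 else -1

theorem exists_pow_eq_of_isPrimitiveRoot_card_sub_one
    (hw : IsPrimitiveRoot w (Fintype.card F - 1)) {a : F} (ha : a ≠ 0) : ∃ j : ℕ, a = w ^ j := by
  have : NeZero (Fintype.card F - 1) := ⟨by have := Fintype.one_lt_card (α := F); omega⟩
  obtain ⟨j, -, hj⟩ := hw.eq_pow_of_pow_eq_one (FiniteField.pow_card_sub_one_eq_one a ha)
  exact ⟨j, hj.symm⟩

/-- Since 4 divides `|F| - 1`, the order of `w`, the exponent of a power of `w` is well defined mod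
4. -/
theorem pow_mem_peisertSet_iff (hw : IsPrimitiveRoot w (Fintype.card F - 1))
    (h4 : Fintype.card F % 4 = 1) (j : ℕ) : w ^ j ∈ peisertSet w ↔ j % 4 = 0 ∨ j % 4 = 1 := by
  refine ⟨fun ⟨k, hk, h⟩ => ?_, fun h => ⟨j, h, rfl⟩⟩
  have hm : j ≡ k [MOD Fintype.card F - 1] := by
    have hw0 : w ≠ 0 := hw.ne_zero (by have := Fintype.one_lt_card (α := F); omega)
    have := pow_eq_pow_iff_modEq.1 (show Units.mk0 w hw0 ^ j = Units.mk0 w hw0 ^ k from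
      Units.ext (by simpa using h))
    rwa [← orderOf_units, Units.val_mk0, ← hw.eq_orderOf] at this
  have hj : j % 4 = k % 4 := hm.of_dvd (by omega)
  rwa [hj]

theorem peisertSign_zero {F : Type*} [Field F] {w : F} : peisertSign w 0 = 0 := if_pos rfl

theorem peisertSign_pow (hw0 : w ≠ 0) (hw : IsPrimitiveRoot w (Fintype.card F - 1))
    (h4 : Fintype.card F % 4 = 1) (j : ℕ) :
    peisertSign w (w ^ j) = if j % 4 = 0 ∨ j % 4 = 1 then 1 else -1 := by
  unfold peisertSign
  rw [if_neg (pow_ne_zero _ hw0)]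
  simp only [pow_mem_peisertSet_iff hw h4]

theorem peisertSign_sq_mul (hw0 : w ≠ 0) (hw : IsPrimitiveRoot w (Fintype.card F - 1))
    (h4 : Fintype.card F % 4 = 1) (a : F) :
    peisertSign w (w ^ 2 * a) = -peisertSign w a := by
  by_cases ha : a = 0
  · simp [ha, peisertSign_zero]
  obtain ⟨j, rfl⟩ := exists_pow_eq_of_isPrimitiveRoot_card_sub_one hw ha
  rw [← pow_add, peisertSign_pow hw0 hw h4, peisertSign_pow hw0 hw h4]
  split_ifs <;> omega

/-- On exponents the two sides are `3 * j` and `j + 1` mod 4; each lies in `{0, 1}` exactly for `j ≡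
0, 3`. -/
theorem peisertSign_pow_prime (hw0 : w ≠ 0) (hw : IsPrimitiveRoot w (Fintype.card F - 1))
    (h4 : Fintype.card F % 4 = 1) {p : ℕ} (hp : p % 4 = 3) (a : F) :
    peisertSign w (a ^ p) = peisertSign w (w * a) := by
  by_cases ha : a = 0
  · rw [ha, zero_pow (by omega), mul_zero]
  obtain ⟨j, rfl⟩ := exists_pow_eq_of_isPrimitiveRoot_card_sub_one hw ha
  rw [← pow_mul, ← pow_succ', peisertSign_pow hw0 hw h4, peisertSign_pow hw0 hw h4]
  have h : j * p % 4 = j % 4 * 3 % 4 := by rw [Nat.mul_mod, hp]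
  split_ifs <;> omega

theorem card_mod_four_of_even_pow {p r : ℕ} (hp4 : p % 4 = 3) (hr : Even r) : p ^ r % 4 = 1 := by
  obtain ⟨s, rfl⟩ := hr
  have hp2 : p * p % 4 = 1 := by simp [Nat.mul_mod, hp4]
  rw [← two_mul, pow_mul, sq, Nat.pow_mod, hp2]
  simp

theorem peisertGraph_isPaleyType {p r : ℕ} (hp : p.Prime) (hp4 : p % 4 = 3) (hr : Even r)
    (hq : 5 ≤ p ^ r) (hF : Fintype.card F = p ^ r) (hw : IsPrimitiveRoot w (Fintype.card F - 1)) :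
    IsPaleyType (peisertGraph F p r hp4 hr hq hF w hw) (peisertSign w) := by
  have h4 : Fintype.card F % 4 = 1 := hF ▸ card_mod_four_of_even_pow hp4 hr
  have hw0 : w ≠ 0 := hw.ne_zero (by omega)
  have : Fact p.Prime := ⟨hp⟩
  have : CharP F p := charP_of_card_eq_prime_pow hF
  have hd : ∀ a : F, a ≠ 0 → peisertSign w a = 1 ∨ peisertSign w a = -1 := fun a ha => by
    unfold peisertSign
    rw [if_neg ha]
    split_ifs <;> simp
  -- Multiplication by `w ^ 2` permutes `F` and negates the sign, so the sum equals its own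
  -- negative.
  have hsum : ∑ z, peisertSign w z = 0 := by
    have h := Equiv.sum_comp (Equiv.mulLeft₀ (w ^ 2) (pow_ne_zero 2 hw0)) (peisertSign w)
    simp only [Equiv.mulLeft₀_apply, peisertSign_sq_mul hw0 hw h4, Finset.sum_neg_distrib] at h
    omega
  have hT2 : ∀ a, autocorrelation (peisertSign w) (w ^ 2 * a) =
      autocorrelation (peisertSign w) a := fun a => by
    rw [autocorrelation_mul _ (pow_ne_zero 2 hw0)]
    unfold autocorrelation
    simp only [peisertSign_sq_mul hw0 hw h4, neg_mul_neg]
  -- Frobenius fixes the shift 1 but twists the sign function exactly as multiplication by `w` does,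
  -- and the latter moves the shift to `w`.
  have hT1 : autocorrelation (peisertSign w) w = autocorrelation (peisertSign w) 1 := by
    conv_rhs => rw [← one_pow p]
    rw [autocorrelation_frobenius]
    have h := autocorrelation_mul (peisertSign w) hw0 1
    rw [mul_one] at h
    rw [h]
    simp only [peisertSign_pow_prime hw0 hw h4 hp4]
  have hT : ∀ j : ℕ, autocorrelation (peisertSign w) (w ^ j) =
      autocorrelation (peisertSign w) 1 := fun j => by
    induction j using Nat.twoStepInduction with
    | zero => rw [pow_zero]
    | one => rw [pow_one, hT1]
    | more j ih _ => rw [add_comm, pow_add, hT2, ih]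
  have hconst : ∀ a : F, a ≠ 0 → autocorrelation (peisertSign w) a =
      autocorrelation (peisertSign w) 1 := fun a ha => by
    obtain ⟨j, rfl⟩ := exists_pow_eq_of_isPrimitiveRoot_card_sub_one hw ha
    exact hT j
  refine ⟨fun x y hxy => ?_, hd, peisertSign_zero, hsum, fun a ha => ?_⟩
  · unfold peisertSign
    rw [if_neg (sub_ne_zero.2 hxy)]
    simp only [peisertGraph, ne_eq, hxy, not_false_eq_true, true_and]
    split_ifs with h <;> simp [h]
  · rw [hconst a ha]
    refine eq_neg_one_of_autocorrelation_eq peisertSign_zero (fun a ha => ?_) hsum hconst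
    rcases hd a ha with h | h <;> rw [h] <;> rfl

end Peisert

/-! ### Neighbour counts in a Taylor double -/

section TaylorDouble

variable {V : Type*} {G : SimpleGraph V}

open Classical in
/-- The sign `1` of an adjacent pair of vertices, `-1` of a non-adjacent one. -/
noncomputable def SimpleGraph.adjSign (G : SimpleGraph V) (x y : V) : ℤˣ :=
  if G.Adj x y then 1 else -1

theorem SimpleGraph.adjSign_comm (x y : V) : G.adjSign x y = G.adjSign y x := by
  unfold SimpleGraph.adjSign
  congr 1
  exact propext (G.adj_comm x y)

/-- Distinct rows of the Seidel matrix of `G` are orthogonal: it is a conference matrix. -/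
def SimpleGraph.IsConference [Fintype V] [DecidableEq V] (G : SimpleGraph V) : Prop :=
  ∀ x y, x ≠ y → ∑ z with z ≠ x ∧ z ≠ y, ((G.adjSign x z * G.adjSign y z : ℤˣ) : ℤ) = 0

/-- Solving for the sign of `b` shows that each vertex has exactly one neighbour in every fibre
other than its own. -/
theorem taylorDouble_adj_iff {a b : V × ℤˣ} :
    (taylorDouble G).Adj a b ↔ a.1 ≠ b.1 ∧ b.2 = a.2 * G.adjSign a.1 b.1 := by
  refine and_congr_right fun _ => ?_
  unfold SimpleGraph.adjSign
  rcases Int.units_eq_one_or a.2 with ha | ha <;> rcases Int.units_eq_one_or b.2 with hb | hb <;>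
    by_cases h : G.Adj a.1 b.1 <;> simp [ha, hb, h]

theorem taylorDouble_adj_neg_right {a b : V × ℤˣ} :
    (taylorDouble G).Adj a (b.1, -b.2) ↔ a.1 ≠ b.1 ∧ ¬(taylorDouble G).Adj a b := by
  rw [taylorDouble_adj_iff, taylorDouble_adj_iff]
  refine and_congr_right fun h => ?_
  rcases Int.units_eq_one_or b.2 with hb | hb <;>
    rcases Int.units_eq_one_or (a.2 * G.adjSign a.1 b.1) with hc | hc <;> simp [hb, hc, h]

theorem taylorDouble_adj_neg_left {a b : V × ℤˣ} :
    (taylorDouble G).Adj (a.1, -a.2) b ↔ a.1 ≠ b.1 ∧ ¬(taylorDouble G).Adj a b := by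
  rw [SimpleGraph.adj_comm, taylorDouble_adj_neg_right, SimpleGraph.adj_comm, ne_comm]

theorem ncard_neighborSet_taylorDouble_inter (a : V × ℤˣ) (C : Set (V × ℤˣ)) :
    ((taylorDouble G).neighborSet a ∩ C).ncard =
      {y | y ≠ a.1 ∧ (y, a.2 * G.adjSign a.1 y) ∈ C}.ncard := by
  rw [← Set.ncard_image_of_injective _ (f := fun y => (y, a.2 * G.adjSign a.1 y))
    fun x y h => (Prod.ext_iff.1 h).1]
  congr 1
  ext ⟨y, ε⟩
  simp only [Set.mem_inter_iff, SimpleGraph.mem_neighborSet, taylorDouble_adj_iff, Set.mem_image,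
    Set.mem_ofPred_eq, Prod.mk.injEq]
  grind

theorem neighborSet_taylorDouble_inter_fiber (a : V × ℤˣ) :
    (taylorDouble G).neighborSet a ∩ {b | b.1 = a.1} = ∅ := by
  ext b
  simp only [Set.mem_inter_iff, SimpleGraph.mem_neighborSet, taylorDouble_adj_iff]
  grind

theorem neighborSet_taylorDouble_inter_compl_fiber (a : V × ℤˣ) :
    (taylorDouble G).neighborSet a ∩ {b | b.1 ≠ a.1} = (taylorDouble G).neighborSet a := by
  ext b
  simp only [Set.mem_inter_iff, SimpleGraph.mem_neighborSet, taylorDouble_adj_iff]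
  grind

theorem ncard_neighborSet_taylorDouble_inter_fiber {a b : V × ℤˣ} (h : a.1 ≠ b.1) :
    ((taylorDouble G).neighborSet a ∩ {c | c.1 = b.1}).ncard = 1 := by
  rw [ncard_neighborSet_taylorDouble_inter, Set.ncard_eq_one]
  exact ⟨b.1, by ext y; simp; grind⟩

theorem neighborSet_taylorDouble_inter_antipode (a : V × ℤˣ) :
    (taylorDouble G).neighborSet a ∩ (taylorDouble G).neighborSet (a.1, -a.2) = ∅ := by
  ext b
  simp only [Set.mem_inter_iff, SimpleGraph.mem_neighborSet, Set.mem_empty_iff_false, iff_false]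
  rintro ⟨h1, h2⟩
  rw [SimpleGraph.adj_comm, taylorDouble_adj_neg_right] at h2
  exact h2.2 h1.symm

theorem neighborSet_inter_singleton_of_adj {W : Type*} {H : SimpleGraph W} {a b : W}
    (h : H.Adj a b) : (H.neighborSet a ∩ {b}).ncard = 1 := by
  rw [Set.inter_eq_right.2 (by simpa using h), Set.ncard_singleton]

theorem neighborSet_inter_singleton_of_not_adj {W : Type*} {H : SimpleGraph W} {a b : W}
    (h : ¬H.Adj a b) : (H.neighborSet a ∩ {b}).ncard = 0 := by
  rw [Set.inter_singleton_eq_empty.2 (by simpa using h), Set.ncard_empty]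

theorem mul_card_filter_eq_of_sum_units_eq_zero {α : Type*} {s : Finset α} {f : α → ℤˣ}
    (h : ∑ i ∈ s, (f i : ℤ) = 0) (u : ℤˣ) : 2 * #{i ∈ s | f i = u} = #s := by
  -- For signs, the indicator of `f i = u` is `(1 + u * f i) / 2`.
  have h1 : ∀ i ∈ s, (2 * (if f i = u then 1 else 0) : ℤ) = 1 + u * f i := fun i _ => by
    rcases Int.units_eq_one_or u with hu | hu <;> rcases Int.units_eq_one_or (f i) with hi | hi <;>
      simp [hu, hi]
  have h2 := Finset.sum_congr rfl h1
  rw [← Finset.mul_sum, Finset.sum_add_distrib, ← Finset.mul_sum, h, mul_zero, add_zero,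
    Finset.sum_boole, Finset.sum_const, nsmul_eq_mul, mul_one] at h2
  exact_mod_cast h2

variable [Fintype V]

theorem ncard_neighborSet_taylorDouble (a : V × ℤˣ) :
    ((taylorDouble G).neighborSet a).ncard = Fintype.card V - 1 := by
  classical
  have h := ncard_neighborSet_taylorDouble_inter (G := G) a Set.univ
  rw [Set.inter_univ] at h
  rw [h, ← Nat.card_eq_fintype_card, ← Set.ncard_univ, ← Set.ncard_sdiff_singleton_of_mem
    (Set.mem_univ a.1)]
  congr 1
  ext y
  simp

theorem ncard_neighborSet_taylorDouble_inter_compl_fiber {a b : V × ℤˣ} (h : a.1 ≠ b.1) :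
    ((taylorDouble G).neighborSet a ∩ {c | c.1 ≠ b.1}).ncard = Fintype.card V - 2 := by
  have h1 := ncard_neighborSet_taylorDouble (G := G) a
  have h2 := Set.ncard_inter_add_ncard_sdiff_eq_ncard ((taylorDouble G).neighborSet a)
    {c | c.1 = b.1} (Set.toFinite _)
  rw [ncard_neighborSet_taylorDouble_inter_fiber h, h1, Set.sdiff_eq] at h2
  have h3 : {c : V × ℤˣ | c.1 ≠ b.1} = {c | c.1 = b.1}ᶜ := rfl
  rw [h3]
  omega

variable [DecidableEq V]

/-- A common neighbour lies over `y` exactly when the product of the two row entries at `y` is `a.2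
* b.2`. Orthogonality makes each sign occur for half of the admissible `y`. -/
theorem ncard_neighborSet_taylorDouble_inter_neighborSet (hG : G.IsConference) {a b : V × ℤˣ}
    (h : a.1 ≠ b.1) :
    ((taylorDouble G).neighborSet a ∩ (taylorDouble G).neighborSet b).ncard =
      (Fintype.card V - 2) / 2 := by
  have h1 := mul_card_filter_eq_of_sum_units_eq_zero (hG _ _ h) (a.2 * b.2)
  have h2 : #{z | z ≠ a.1 ∧ z ≠ b.1} = Fintype.card V - 2 := by
    have : ({z | z ≠ a.1 ∧ z ≠ b.1} : Finset V) = {a.1, b.1}ᶜ := by ext; simp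
    rw [this, Finset.card_compl, Finset.card_pair h]
  rw [h2] at h1
  rw [ncard_neighborSet_taylorDouble_inter, ← h1, Nat.mul_div_cancel_left _ two_pos,
    ← Set.ncard_coe_finset]
  congr 1
  ext y
  simp only [SimpleGraph.mem_neighborSet, taylorDouble_adj_iff, Set.mem_ofPred_eq, coe_filter,
    Finset.mem_filter, Finset.mem_univ, true_and]
  have key : a.2 * G.adjSign a.1 y = b.2 * G.adjSign b.1 y ↔
      G.adjSign a.1 y * G.adjSign b.1 y = a.2 * b.2 := by
    rcases Int.units_eq_one_or a.2 with ha | ha <;> rcases Int.units_eq_one_or b.2 with hb | hb <;>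
    rcases Int.units_eq_one_or (G.adjSign a.1 y) with hc | hc <;>
    rcases Int.units_eq_one_or (G.adjSign b.1 y) with hd | hd <;> simp [ha, hb, hc, hd]
  rw [key, and_assoc, ne_comm (a := b.1)]

end TaylorDouble

/-! ### The cone over a Paley type graph is a conference graph -/

section Cone

variable {F : Type*} [Field F] [Fintype F] {Δ : SimpleGraph F} {ψ : F → ℤ}

theorem IsPaleyType.adjSign_some_some (h : IsPaleyType Δ ψ) {x y : F} (hxy : x ≠ y) :
    (((coneGraph Δ).adjSign (some x) (some y) : ℤˣ) : ℤ) = ψ (x - y) := by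
  unfold SimpleGraph.adjSign
  have h1 : (coneGraph Δ).Adj (some x) (some y) ↔ ψ (x - y) = 1 := h.adj_of_ne x y hxy
  rcases h.dichotomy _ (sub_ne_zero.2 hxy) with h2 | h2 <;> simp [h1, h2]

theorem adjSign_coneGraph_none_some {V : Type*} (Δ : SimpleGraph V) (x : V) :
    (coneGraph Δ).adjSign none (some x) = 1 := if_pos trivial

theorem IsPaleyType.isConference_coneGraph [DecidableEq F] (h : IsPaleyType Δ ψ) :
    (coneGraph Δ).IsConference := by
  have key : ∀ y : F, ∑ z with z ≠ none ∧ z ≠ some y,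
      (((coneGraph Δ).adjSign none z * (coneGraph Δ).adjSign (some y) z : ℤˣ) : ℤ) = 0 := by
    intro y
    rw [Finset.sum_filter, Fintype.sum_option]
    simp only [ne_eq, not_true_eq_false, false_and, if_false, zero_add, reduceCtorEq,
      not_false_eq_true, true_and, Option.some.injEq, adjSign_coneGraph_none_some, one_mul]
    have hs := h.sum_eq_zero
    -- The row of `∞` is all ones; the excluded column `y` is harmless because `ψ 0 = 0`.
    rw [← Equiv.sum_comp (Equiv.subLeft y)] at hs
    refine Eq.trans ?_ hs
    refine Finset.sum_congr rfl fun z _ => ?_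
    by_cases hz : z = y
    · simp [hz, h.zero]
    · rw [if_pos hz, h.adjSign_some_some (Ne.symm hz), Equiv.subLeft_apply]
  rintro (_ | x) (_ | y) hxy
  · exact absurd rfl hxy
  · exact key y
  · simpa only [and_comm, mul_comm] using key x
  · have hne : x ≠ y := fun e => hxy (congrArg some e)
    rw [Finset.sum_filter, Fintype.sum_option]
    simp only [ne_eq, reduceCtorEq, not_false_eq_true, and_self, if_true, Option.some.injEq,
      (coneGraph Δ).adjSign_comm (some _) none, adjSign_coneGraph_none_some, mul_one,
      Units.val_one]
    have hT := h.autocorrelation_eq _ (sub_ne_zero.2 hne)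
    unfold autocorrelation at hT
    rw [← Equiv.sum_comp (Equiv.subLeft x)] at hT
    -- The column `∞` contributes 1, the finite columns the autocorrelation `-1` at `x - y`.
    rw [← add_neg_cancel (1 : ℤ)]
    refine congrArg _ (Eq.trans ?_ hT)
    refine Finset.sum_congr rfl fun z _ => ?_
    rw [Equiv.subLeft_apply, sub_sub_sub_cancel_left]
    by_cases hx : z = x
    · simp [hx, h.zero]
    by_cases hy : z = y
    · simp [hy, h.zero]
    rw [if_pos ⟨hx, hy⟩, Units.val_mul, h.adjSign_some_some (Ne.symm hx),
      h.adjSign_some_some (Ne.symm hy)]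

end Cone

/-! ### Neighbour counts in a bipartite double -/

section BipartiteDouble

variable {W : Type*} {S : SimpleGraph W}

/-- The copy of `u` on the side `i` of the bipartite double. -/
def onSide (i : Bool) (u : W) : W ⊕ W := cond i (Sum.inr u) (Sum.inl u)

theorem onSide_injective (i : Bool) : Function.Injective (onSide i : W → W ⊕ W) := by
  cases i
  · exact Sum.inl_injective
  · exact Sum.inr_injective

theorem onSide_inj {i j : Bool} {u v : W} : onSide i u = onSide j v ↔ i = j ∧ u = v := by
  cases i <;> cases j <;> simp [onSide]

theorem exists_onSide (x : W ⊕ W) : ∃ i u, x = onSide i u := by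
  rcases x with u | u
  · exact ⟨false, u, rfl⟩
  · exact ⟨true, u, rfl⟩

theorem bipartiteDoubleCover_adj_onSide {i j : Bool} {u v : W} :
    S.bipartiteDoubleCover.Adj (onSide i u) (onSide j v) ↔ i ≠ j ∧ S.Adj u v := by
  cases i <;> cases j <;> simp [onSide]

theorem neighborSet_onSide (i : Bool) (u : W) :
    S.bipartiteDoubleCover.neighborSet (onSide i u) = onSide (!i) '' S.neighborSet u := by
  ext x
  obtain ⟨j, v, rfl⟩ := exists_onSide x
  simp only [SimpleGraph.mem_neighborSet, bipartiteDoubleCover_adj_onSide, Set.mem_image,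
    onSide_inj]
  cases i <;> cases j <;> simp

theorem ncard_neighborSet_onSide (i : Bool) (u : W) :
    (S.bipartiteDoubleCover.neighborSet (onSide i u)).ncard = (S.neighborSet u).ncard := by
  rw [neighborSet_onSide, Set.ncard_image_of_injective _ (onSide_injective _)]

theorem disjoint_image_onSide {i j : Bool} (h : i ≠ j) (C D : Set W) :
    Disjoint (onSide i '' C) (onSide j '' D) := by
  rw [Set.disjoint_left]
  rintro _ ⟨u, -, rfl⟩ ⟨v, -, hv⟩
  exact h (onSide_inj.1 hv).1.symm

theorem ncard_neighborSet_onSide_inter (i j : Bool) (u : W) (C : Set W) :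
    (S.bipartiteDoubleCover.neighborSet (onSide i u) ∩ onSide j '' C).ncard =
      if i = j then 0 else (S.neighborSet u ∩ C).ncard := by
  rw [neighborSet_onSide]
  split_ifs with h
  · rw [(disjoint_image_onSide (by simp [h]) _ _).inter_eq, Set.ncard_empty]
  · obtain rfl : j = !i := by cases i <;> cases j <;> simp_all
    rw [← Set.image_inter (onSide_injective _), Set.ncard_image_of_injective _ (onSide_injective _)]

theorem commonNeighbors_onSide_of_ne {i j : Bool} (h : i ≠ j) (u v : W) :
    (S.bipartiteDoubleCover.commonNeighbors (onSide i u) (onSide j v)) = ∅ := by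
  rw [SimpleGraph.commonNeighbors_eq, neighborSet_onSide, neighborSet_onSide]
  exact (disjoint_image_onSide (by simpa using h) _ _).inter_eq

theorem ncard_commonNeighbors_onSide (i : Bool) (u v : W) :
    (S.bipartiteDoubleCover.commonNeighbors (onSide i u) (onSide i v)).ncard =
      (S.neighborSet u ∩ S.neighborSet v).ncard := by
  rw [SimpleGraph.commonNeighbors_eq, neighborSet_onSide, neighborSet_onSide,
    ← Set.image_inter (onSide_injective _), Set.ncard_image_of_injective _ (onSide_injective _)]

end BipartiteDouble

/-! ### The bipartite double of a Taylor double -/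

section TaylorBipartiteDouble

variable {V : Type*} [Fintype V] [DecidableEq V] {G : SimpleGraph V}

theorem edist_onSide_le_two (hG : G.IsConference) (hV : 4 ≤ Fintype.card V) {a b : V × ℤˣ}
    (h : a.1 ≠ b.1) (i : Bool) :
    (taylorDouble G).bipartiteDoubleCover.edist (onSide i a) (onSide i b) ≤ 2 := by
  refine le_of_eq (SimpleGraph.edist_eq_two_iff.2 ⟨fun e => h (by rw [(onSide_inj.1 e).2]),
    fun e => (bipartiteDoubleCover_adj_onSide.1 e).1 rfl, Set.nonempty_of_ncard_ne_zero ?_⟩)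
  rw [ncard_commonNeighbors_onSide, ncard_neighborSet_taylorDouble_inter_neighborSet hG h]
  omega

theorem exists_adj_taylorDouble_ne (hV : 4 ≤ Fintype.card V) (a b : V × ℤˣ) :
    ∃ c, (taylorDouble G).Adj a c ∧ c.1 ≠ b.1 := by
  obtain ⟨y, hy⟩ := Finset.exists_mem_notMem_of_card_lt_card (s := {a.1, b.1})
    (t := (Finset.univ : Finset V))
    (lt_of_le_of_lt Finset.card_le_two (by rw [Finset.card_univ]; omega))
  simp only [Finset.mem_insert, Finset.mem_singleton, not_or] at hy
  exact ⟨(y, a.2 * G.adjSign a.1 y), taylorDouble_adj_iff.2 ⟨Ne.symm hy.2.1, rfl⟩, hy.2.2⟩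

theorem edist_taylor_le_four (hG : G.IsConference) (hV : 4 ≤ Fintype.card V)
    (x y : (V × ℤˣ) ⊕ (V × ℤˣ)) : (taylorDouble G).bipartiteDoubleCover.edist x y ≤ 4 := by
  obtain ⟨i, a, rfl⟩ := exists_onSide x
  obtain ⟨j, b, rfl⟩ := exists_onSide y
  -- The same `c` serves both cases: on equal sides its copy is within 2 of both ends, on opposite
  -- sides it is a neighbour of `x` and within 2 of `y`.
  obtain ⟨c, hac, hcb⟩ := exists_adj_taylorDouble_ne (G := G) hV a b
  by_cases hij : i = j
  · subst hij
    calc _ ≤ _ + _ := SimpleGraph.edist_triangle (v := onSide i c)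
      _ ≤ 2 + 2 := add_le_add (edist_onSide_le_two hG hV (taylorDouble_adj_iff.1 hac).1 i)
          (edist_onSide_le_two hG hV hcb i)
      _ = 4 := by norm_num
  · calc _ ≤ _ + _ := SimpleGraph.edist_triangle (v := onSide j c)
      _ ≤ 1 + 2 := add_le_add
          (SimpleGraph.edist_eq_one_iff_adj.2 (bipartiteDoubleCover_adj_onSide.2 ⟨hij, hac⟩)).le
          (edist_onSide_le_two hG hV hcb j)
      _ ≤ 4 := by norm_num

omit [Fintype V] [DecidableEq V] in
-- Antipodes have no common neighbour, so their distance exceeds 2; it is not 3 because each edge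
-- changes sides.
theorem four_le_edist_antipode (i : Bool) (a : V × ℤˣ) :
    4 ≤ (taylorDouble G).bipartiteDoubleCover.edist (onSide i a) (onSide i (a.1, -a.2)) := by
  by_contra! hlt
  have hcommon : (taylorDouble G).bipartiteDoubleCover.commonNeighbors (onSide i a)
      (onSide i (a.1, -a.2)) = ∅ := by
    rw [SimpleGraph.commonNeighbors_eq, neighborSet_onSide, neighborSet_onSide,
      ← Set.image_inter (onSide_injective _), neighborSet_taylorDouble_inter_antipode,
      Set.image_empty]
  have h2 : 2 < (taylorDouble G).bipartiteDoubleCover.edist (onSide i a)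
      (onSide i (a.1, -a.2)) := by
    refine SimpleGraph.two_lt_edist_iff.2 ⟨fun e => ?_,
      fun e => (bipartiteDoubleCover_adj_onSide.1 e).1 rfl, hcommon⟩
    have := (Prod.ext_iff.1 (onSide_inj.1 e).2).2
    exact units_ne_neg_self a.2 this
  obtain ⟨p, hp⟩ := SimpleGraph.exists_walk_of_edist_ne_top hlt.ne_top
  rw [← hp] at hlt h2
  norm_cast at hlt h2
  have h01 := p.adj_getVert_succ (i := 0) (by omega)
  have h12 := p.adj_getVert_succ (i := 1) (by omega)
  have h23 := p.adj_getVert_succ (i := 2) (by omega)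
  have h3 : p.getVert (2 + 1) = onSide i (a.1, -a.2) := p.getVert_of_length_le (by omega)
  rw [p.getVert_zero] at h01
  rw [h3] at h23
  obtain ⟨j, u, hu⟩ := exists_onSide (p.getVert 1)
  obtain ⟨k, v, hv⟩ := exists_onSide (p.getVert 2)
  rw [hu, bipartiteDoubleCover_adj_onSide] at h01
  rw [hu, hv, bipartiteDoubleCover_adj_onSide] at h12
  rw [hv, bipartiteDoubleCover_adj_onSide] at h23
  have := h01.1; have := h12.1; have := h23.1
  cases i <;> cases j <;> cases k <;> simp_all

theorem diam_taylorBipartiteDouble (hG : G.IsConference) (hV : 4 ≤ Fintype.card V) :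
    (taylorDouble G).bipartiteDoubleCover.diam = 4 := by
  obtain ⟨x⟩ : Nonempty V := Fintype.card_pos_iff.1 (by omega)
  have h : (taylorDouble G).bipartiteDoubleCover.ediam = 4 := le_antisymm
    (SimpleGraph.ediam_le_iff.2 (edist_taylor_le_four hG hV))
    ((four_le_edist_antipode false (x, 1)).trans SimpleGraph.edist_le_ediam)
  rw [SimpleGraph.diam, h]
  rfl

theorem connected_taylorBipartiteDouble (hG : G.IsConference) (hV : 4 ≤ Fintype.card V) :
    (taylorDouble G).bipartiteDoubleCover.Connected := by
  obtain ⟨x⟩ : Nonempty V := Fintype.card_pos_iff.1 (by omega)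
  have : Nonempty ((V × ℤˣ) ⊕ (V × ℤˣ)) := ⟨Sum.inl (x, 1)⟩
  refine ⟨fun u v => SimpleGraph.reachable_of_edist_ne_top ?_⟩
  exact ((edist_taylor_le_four hG hV u v).trans_lt (by decide)).ne

theorem isAmplyRegular_taylorBipartiteDouble (hG : G.IsConference) {q : ℕ}
    (hV : Fintype.card V = q + 1) :
    IsAmplyRegular (taylorDouble G).bipartiteDoubleCover (4 * (q + 1)) q 0 ((q - 1) / 2) where
  card := by
    rw [Nat.card_eq_fintype_card, Fintype.card_sum, Fintype.card_prod, hV, Fintype.card_units_int]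
    omega
  regular x := by
    obtain ⟨i, a, rfl⟩ := exists_onSide x
    rw [ncard_neighborSet_onSide, ncard_neighborSet_taylorDouble, hV, Nat.add_sub_cancel]
  of_adj x y h := by
    obtain ⟨i, a, rfl⟩ := exists_onSide x
    obtain ⟨j, b, rfl⟩ := exists_onSide y
    rw [commonNeighbors_onSide_of_ne (bipartiteDoubleCover_adj_onSide.1 h).1, Set.ncard_empty]
  of_dist_two x y h := by
    obtain ⟨i, a, rfl⟩ := exists_onSide x
    obtain ⟨j, b, rfl⟩ := exists_onSide y
    have hr := SimpleGraph.Reachable.of_dist_ne_zero (G := (taylorDouble G).bipartiteDoubleCover)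
      (u := onSide i a) (v := onSide j b)
      (by omega)
    have he : (taylorDouble G).bipartiteDoubleCover.edist (onSide i a) (onSide j b) = 2 := by
      rw [← hr.coe_dist_eq_edist, h]
      rfl
    obtain ⟨hne, -, hc⟩ := SimpleGraph.edist_eq_two_iff.1 he
    have hij : i = j := by
      by_contra hij
      rw [commonNeighbors_onSide_of_ne hij] at hc
      exact Set.not_nonempty_empty hc
    subst hij
    -- Otherwise `b` would be the antipode of `a`, at distance at least 4.
    have hab : a.1 ≠ b.1 := fun hab => by
      have hb : b = (a.1, -a.2) := by
        have h2 : b.2 ≠ a.2 := fun h2 => hne (by rw [Prod.ext hab h2.symm])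
        exact Prod.ext hab.symm (Int.units_ne_iff_eq_neg.1 h2)
      have h4 := four_le_edist_antipode (G := G) i a
      rw [← hb, he] at h4
      exact absurd h4 (by decide)
    rw [ncard_commonNeighbors_onSide, ncard_neighborSet_taylorDouble_inter_neighborSet hG hab, hV]
    omega

/-- The underlying sets of the cells of the partition around a copy of `a`. -/
def taylorCell (G : SimpleGraph V) (a : V × ℤˣ) : Fin 6 → Set (V × ℤˣ) :=
  ![{a}, (taylorDouble G).neighborSet a, {b | b.1 ≠ a.1},
    (taylorDouble G).neighborSet (a.1, -a.2), {(a.1, -a.2)}, {b | b.1 = a.1}]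

/-- The side of the cells of the partition around a vertex on the side `i`. -/
def taylorCellSide (i : Bool) : Fin 6 → Bool := ![i, !i, i, !i, i, !i]

omit [Fintype V] [DecidableEq V] in
theorem ncard_fiber (x : V) : {b : V × ℤˣ | b.1 = x}.ncard = 2 := by
  have : {b : V × ℤˣ | b.1 = x} = {(x, 1), (x, -1)} := by
    ext ⟨y, ε⟩
    rcases Int.units_eq_one_or ε with h | h <;> simp [h]
  rw [this, Set.ncard_pair (by simp)]

omit [Fintype V] [DecidableEq V] in
theorem disjoint_taylorCell (i : Bool) (a : V × ℤˣ) {j k : Fin 6} (hjk : j ≠ k) :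
    Disjoint (onSide (taylorCellSide i j) '' taylorCell G a j)
      (onSide (taylorCellSide i k) '' taylorCell G a k) := by
  by_cases hs : taylorCellSide i j = taylorCellSide i k
  · rw [hs, Set.disjoint_image_iff (onSide_injective _), Set.disjoint_left]
    intro b
    have h1 : (taylorDouble G).Adj a b → a.1 ≠ b.1 := fun h => (taylorDouble_adj_iff.1 h).1
    have h2 := taylorDouble_adj_neg_left (G := G) (a := a) (b := b)
    have h3 := units_ne_neg_self a.2
    fin_cases j <;> fin_cases k <;>
      simp [taylorCellSide, taylorCell] at hs hjk ⊢ <;> grind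
  · exact disjoint_image_onSide hs _ _

omit [Fintype V] [DecidableEq V] in
-- On the side of `a`, a vertex is `a`, its antipode, or in another fibre. On the opposite side it
-- is in the fibre of `a`, or adjacent to exactly one of `a` and its antipode.
theorem iUnion_taylorCell (i : Bool) (a : V × ℤˣ) :
    ⋃ j, onSide (taylorCellSide i j) '' taylorCell G a j = Set.univ := by
  rw [Set.eq_univ_iff_forall]
  intro x
  obtain ⟨s, b, rfl⟩ := exists_onSide x
  rw [Set.mem_iUnion]
  suffices ∃ j, taylorCellSide i j = s ∧ b ∈ taylorCell G a j by
    obtain ⟨j, rfl, h⟩ := this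
    exact ⟨j, b, h, rfl⟩
  by_cases hs : s = i
  · subst hs
    by_cases hab : b.1 = a.1
    · by_cases h2 : b.2 = a.2
      · exact ⟨0, rfl, Prod.ext hab h2⟩
      · exact ⟨4, rfl, Prod.ext hab (Int.units_ne_iff_eq_neg.1 h2)⟩
    · exact ⟨2, rfl, hab⟩
  · obtain rfl : s = !i := by cases i <;> cases s <;> simp_all
    by_cases hab : b.1 = a.1
    · exact ⟨5, rfl, hab⟩
    · by_cases h : (taylorDouble G).Adj a b
      · exact ⟨1, rfl, h⟩
      · exact ⟨3, rfl, taylorDouble_adj_neg_left.2 ⟨Ne.symm hab, h⟩⟩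

theorem quot_taylorCell (hG : G.IsConference) {q : ℕ} (hV : Fintype.card V = q + 1) (i : Bool)
    (a b : V × ℤˣ) (j k : Fin 6) (hb : b ∈ taylorCell G a j) :
    (if taylorCellSide i j = taylorCellSide i k then 0
      else ((taylorDouble G).neighborSet b ∩ taylorCell G a k).ncard) =
      (diagramSix q).quot j k := by
  -- For concrete `j` and `k` both sides reduce to `i` or `!i`, so the condition is settled by
  -- `rfl`, `hi` or `hi'`.
  have hi : ¬i = !i := by simp
  have hi' : ¬(!i) = i := by simp
  have hN : ∀ b, ((taylorDouble G).neighborSet b).ncard = q := fun b => by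
    rw [ncard_neighborSet_taylorDouble, hV, Nat.add_sub_cancel]
  have hadj : ∀ c, (taylorDouble G).Adj c b → b.1 ≠ c.1 :=
    fun c h => (taylorDouble_adj_iff.1 h).1.symm
  have hdiff : b.1 ≠ a.1 →
      ((taylorDouble G).neighborSet b ∩ {c | c.1 ≠ a.1}).ncard = q - 1 := fun h => by
    rw [ncard_neighborSet_taylorDouble_inter_compl_fiber h, hV]
    rfl
  have hmu : ∀ c : V × ℤˣ, b.1 ≠ c.1 →
      ((taylorDouble G).neighborSet b ∩ (taylorDouble G).neighborSet c).ncard = (q - 1) / 2 :=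
    fun c h => by
      rw [ncard_neighborSet_taylorDouble_inter_neighborSet hG h, hV]
      rfl
  have hempty := neighborSet_taylorDouble_inter_antipode (G := G) a
  fin_cases j
  · obtain rfl : b = a := hb
    fin_cases k
    · exact if_pos rfl
    · exact (if_neg hi).trans ((congrArg _ (Set.inter_self _)).trans (hN _))
    · exact if_pos rfl
    · exact (if_neg hi).trans ((congrArg _ hempty).trans (Set.ncard_empty _))
    · exact if_pos rfl
    · exact (if_neg hi).trans
        ((congrArg _ (neighborSet_taylorDouble_inter_fiber _)).trans (Set.ncard_empty _))
  · replace hb : (taylorDouble G).Adj a b := hb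
    fin_cases k
    · exact (if_neg hi').trans (neighborSet_inter_singleton_of_adj hb.symm)
    · exact if_pos rfl
    · exact (if_neg hi').trans (hdiff (hadj a hb))
    · exact if_pos rfl
    · exact (if_neg hi').trans (neighborSet_inter_singleton_of_not_adj fun h =>
        (taylorDouble_adj_neg_right.1 h).2 hb.symm)
    · exact if_pos rfl
  · replace hb : b.1 ≠ a.1 := hb
    fin_cases k
    · exact if_pos rfl
    · exact (if_neg hi).trans (hmu a hb)
    · exact if_pos rfl
    · exact (if_neg hi).trans (hmu (a.1, -a.2) hb)
    · exact if_pos rfl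
    · exact (if_neg hi).trans (ncard_neighborSet_taylorDouble_inter_fiber hb)
  · replace hb : (taylorDouble G).Adj (a.1, -a.2) b := hb
    fin_cases k
    · exact (if_neg hi').trans (neighborSet_inter_singleton_of_not_adj fun h =>
        (taylorDouble_adj_neg_left.1 hb).2 h.symm)
    · exact if_pos rfl
    · exact (if_neg hi').trans (hdiff (hadj (a.1, -a.2) hb))
    · exact if_pos rfl
    · exact (if_neg hi').trans (neighborSet_inter_singleton_of_adj hb.symm)
    · exact if_pos rfl
  · obtain rfl : b = (a.1, -a.2) := hb
    fin_cases k
    · exact if_pos rfl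
    · exact (if_neg hi).trans
        ((congrArg _ ((Set.inter_comm _ _).trans hempty)).trans (Set.ncard_empty _))
    · exact if_pos rfl
    · exact (if_neg hi).trans ((congrArg _ (Set.inter_self _)).trans (hN _))
    · exact if_pos rfl
    · exact (if_neg hi).trans
        ((congrArg _ (neighborSet_taylorDouble_inter_fiber (a.1, -a.2))).trans (Set.ncard_empty _))
  · replace hb : b.1 = a.1 := hb
    fin_cases k
    · exact (if_neg hi').trans
        (neighborSet_inter_singleton_of_not_adj fun h => hadj _ h.symm hb)
    · exact if_pos rfl
    · refine (if_neg hi').trans (Eq.trans ?_ (hN b))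
      have h := neighborSet_taylorDouble_inter_compl_fiber (G := G) b
      rw [hb] at h
      exact congrArg _ h
    · exact if_pos rfl
    · exact (if_neg hi').trans
        (neighborSet_inter_singleton_of_not_adj fun h => hadj _ h.symm hb)
    · exact if_pos rfl

theorem isQRegular_taylorBipartiteDouble (hG : G.IsConference) {q : ℕ}
    (hV : Fintype.card V = q + 1) (hq : 3 ≤ q) :
    IsQRegular (taylorDouble G).bipartiteDoubleCover (diagramSix q) := by
  intro x
  obtain ⟨i, a, rfl⟩ := exists_onSide x
  refine ⟨fun j => onSide (taylorCellSide i j) '' taylorCell G a j, ?_, 0, by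
    simp [taylorCell, taylorCellSide]⟩
  have hN : ∀ b, ((taylorDouble G).neighborSet b).ncard = q := fun b => by
    rw [ncard_neighborSet_taylorDouble, hV, Nat.add_sub_cancel]
  have hcard : ∀ j, (onSide (taylorCellSide i j) '' taylorCell G a j).ncard =
      (diagramSix q).size j := fun j => by
    rw [Set.ncard_image_of_injective _ (onSide_injective _)]
    have h2 : {b : V × ℤˣ | b.1 ≠ a.1}.ncard = 2 * q := by
      have h := Set.ncard_add_ncard_compl {b : V × ℤˣ | b.1 = a.1}
      rw [ncard_fiber, Nat.card_eq_fintype_card, Fintype.card_prod, hV, Fintype.card_units_int] at h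
      have h3 : {c : V × ℤˣ | c.1 ≠ a.1} = {c | c.1 = a.1}ᶜ := rfl
      rw [h3]
      omega
    fin_cases j
    · exact Set.ncard_singleton _
    · exact hN _
    · exact h2
    · exact hN _
    · exact Set.ncard_singleton _
    · exact ncard_fiber _
  have hne : ∀ b : V × ℤˣ, (b.1, -b.2) ≠ b := fun b h =>
    units_ne_neg_self b.2 (Prod.ext_iff.1 h).2.symm
  refine ⟨fun j => Set.nonempty_of_ncard_ne_zero ?_, ?_, ?_, hcard, ?_⟩
  · rw [hcard]
    fin_cases j <;> simp [diagramSix] <;> omega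
  · exact fun j k hjk => disjoint_taylorCell i a hjk
  · exact iUnion_taylorCell i a
  · rintro j k _ ⟨b, hb, rfl⟩
    rw [ncard_neighborSet_onSide_inter]
    exact quot_taylorCell hG hV i a b j k hb

end TaylorBipartiteDouble

theorem proposition3p1 {F : Type*} [Field F] [Fintype F] (q : ℕ) (hFq : Fintype.card F = q)
    (Δ : SimpleGraph F)
    (hΔ : (∃ hF : Fintype.card F % 4 = 1, Δ = paleyGraph F hF) ∨
      (∃ (p r : ℕ) (_ : p.Prime) (hp4 : p % 4 = 3) (hr : Even r) (hq : 5 ≤ p ^ r)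
        (hF : Fintype.card F = p ^ r) (w : F) (hw : IsPrimitiveRoot w (Fintype.card F - 1)),
        Δ = peisertGraph F p r hp4 hr hq hF w hw)) :
    let Γ := (taylorExtension Δ).bipartiteDoubleCover
    Γ.Connected ∧ Γ.IsBipartite ∧ Γ.diam = 4 ∧
      IsAmplyRegular Γ (4 * (q + 1)) q 0 ((q - 1) / 2) ∧
      IsQRegular Γ (diagramSix q) := by
  classical
  intro Γ
  have h5 : 5 ≤ q := by
    rcases hΔ with ⟨hF, -⟩ | ⟨p, r, -, -, -, hq, hF, -⟩
    · have := Fintype.one_lt_card (α := F)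
      -- A field has more than one element, so `q ≡ 1 (mod 4)` forces `q ≥ 5`.
      omega
    · omega
  have hG : (coneGraph Δ).IsConference := by
    rcases hΔ with ⟨hF, rfl⟩ | ⟨p, r, hp, hp4, hr, hq, hF, w, hw, rfl⟩
    · exact (paleyGraph_isPaleyType hF).isConference_coneGraph
    · exact (peisertGraph_isPaleyType hp hp4 hr hq hF hw).isConference_coneGraph
  have hV : Fintype.card (Option F) = q + 1 := by rw [Fintype.card_option, hFq]
  exact ⟨connected_taylorBipartiteDouble hG (by omega),
    SimpleGraph.isBipartite_bipartiteDoubleCover, diam_taylorBipartiteDouble hG (by omega),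
    isAmplyRegular_taylorBipartiteDouble hG hV, isQRegular_taylorBipartiteDouble hG hV (by omega)⟩
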